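/- For a positive integer $n$, let $\mathcal{D}_n$ be the set of derangements (permutations without fixed points) in the symmetric group $\mathfrak{S}_n$ of permutations of $\{1,\dots,n\}$. For $w\in\mathfrak{S}_n$ let $\mathrm{Des}(w)=\{i\in\{1,\dots,n-1\} : w(i)>w(i+1)\}$, let $\mathrm{des}(w)$ be the number of elements of $\mathrm{Des}(w)$ and $\mathrm{maj}(w)$ their sum, and put $$D_n(x,q)=\sum_{w\in\mathcal{D}_n}x^{\mathrm{des}(w)}q^{\mathrm{maj}(w)}.$$ Let $[m]_q=1+q+\cdots+q^{m-1}$ and $[m]_q!=[1]_q[2]_q\cdots[m]_q$; let $\binom{m}{k}_q=\frac{[m]_q!}{[k]_q!\,[m-k]_q!}$ for $0\le k\le m$ and $\binom{m}{k}_q=0$ for $k>m$; and let $(x;q)_{m}=(1-x)(1-xq)\cdots(1-xq^{m-1})$. Then for every positive integer $n$, $$\sum_{m\ge 0}\,\sum_{k=0}^{n}(-1)^k q^{\binom{k}{2}}\binom{m+1}{k}_q\,[m+1]_q^{\,n-k}\,x^m=\frac{D_n(x,q)}{(x;q)_{n+1}}$$ as formal power series in $x$ with coefficients in the field $K(q)$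 of rational functions in $q$ over any field $K$ (for example $K=\mathbb{C}$). -/

import Mathlib

namespace EulerMahonian

/-- The descent set of a permutation `w` of `n` letters, as a set of positions in
`{1, …, n - 1}`. The letters `1, …, n` are represented by `0, …, n - 1` in `Fin n`, so the
one-based positions `i` and `i + 1` are the elements `i - 1` and `i` of `Fin n`. -/
def descentSet {n : ℕ} (w : Equiv.Perm (Fin n)) : Finset ℕ :=
  (Finset.Ico 1 n).filter fun i =>
    ∃ h : i < n, w ⟨i, h⟩ < w ⟨i - 1, lt_of_le_of_lt (Nat.sub_le i 1) h⟩

/-- The descent number: the number of descents. -/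
def des {n : ℕ} (w : Equiv.Perm (Fin n)) : ℕ := (descentSet w).card

/-- The major index: the sum of all descents. -/
def maj {n : ℕ} (w : Equiv.Perm (Fin n)) : ℕ := ∑ i ∈ descentSet w, i

/-- `D_n(x, q) = ∑ x ^ des w * q ^ maj w`, the sum being over all derangements `w` of `n`
letters, for elements `x`, `q` of a commutative ring. -/
def derangementPoly {R : Type*} [CommRing R] (n : ℕ) (x q : R) : R :=
  ∑ w ∈ Finset.univ.filter (fun w : Equiv.Perm (Fin n) => w ∈ derangements (Fin n)),
    x ^ des w * q ^ maj w

/-- `(x; q)_n = (1 - x) (1 - x q) ⋯ (1 - x q ^ (n - 1))`. -/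
def qPochhammer {R : Type*} [CommRing R] (x q : R) (n : ℕ) : R :=
  ∏ i ∈ Finset.range n, (1 - x * q ^ i)

/-- `[n]_q = 1 + q + ⋯ + q ^ (n - 1)`. -/
def qNumber {R : Type*} [CommRing R] (q : R) (n : ℕ) : R :=
  ∑ i ∈ Finset.range n, q ^ i

/-- `[n]_q! = [1]_q [2]_q ⋯ [n]_q`. -/
def qFactorial {R : Type*} [CommRing R] (q : R) (n : ℕ) : R :=
  ∏ i ∈ Finset.range n, qNumber q (i + 1)

/-- The `q`-binomial coefficient `[n]_q! / ([k]_q! [n - k]_q!)` if `k ≤ n`, and `0` if `n < k`.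
It is used only for the indeterminate `q` of a field of rational functions, where no
`q`-factorial vanishes. -/
def qBinomial {L : Type*} [Field L] (q : L) (n k : ℕ) : L :=
  if k ≤ n then qFactorial q n / (qFactorial q k * qFactorial q (n - k)) else 0

end EulerMahonian

/-! Both sides count words of length n in the letters 0, …, m, a word weighted by q to the sum of
its letters. The words whose stable decreasing sort is `w` become, once sorted, the weakly
decreasing sequences that drop strictly at the descents of `w`. Summed over m with x ^ m they give
x^des q^maj / (x; q)_{n+1} (`mk_chainSum_descentSet`). The right side thus counts the words whose
sort is a derangement.

A position is fixed by the sort iff as many larger letters follow it as smaller ones precede it.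
Each word admits exactly one result of inserting a fixed letter v, and smaller fixed letters are
unaffected (`sum_hasFixedLetter`). Forbidding fixed letters 0, 1, …, m in turn gives F(v + 1, n + 1)
= F(v, n + 1) - q ^ v F(v, n), which the alternating sum satisfies by the q-Pascal rule. -/

namespace EulerMahonian

/-! ### q-binomial coefficients and the alternating sum -/

section QBinomial

variable {L : Type*} [Field L] {q : L}

theorem qFactorial_succ {R : Type*} [CommRing R] (q : R) (n : ℕ) :
    qFactorial q (n + 1) = qFactorial q n * qNumber q (n + 1) :=
  Finset.prod_range_succ _ _

theorem qNumber_add {R : Type*} [CommRing R] (q : R) (m n : ℕ) :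
    qNumber q (m + n) = qNumber q m + q ^ m * qNumber q n := by
  simp [qNumber, Finset.sum_range_add, Finset.mul_sum, pow_add]

theorem qFactorial_ne_zero (hq : ∀ k, qNumber q (k + 1) ≠ 0) (n : ℕ) : qFactorial q n ≠ 0 :=
  Finset.prod_ne_zero_iff.2 fun i _ => hq i

theorem qBinomial_zero_right (hq : ∀ k, qNumber q (k + 1) ≠ 0) (n : ℕ) :
    qBinomial q n 0 = 1 := by
  have h := qFactorial_ne_zero hq n
  have h0 : qFactorial q 0 = 1 := Finset.prod_range_zero _
  simp [qBinomial, h0, h]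

theorem qBinomial_eq_zero_of_lt {n k : ℕ} (h : n < k) : qBinomial q n k = 0 :=
  if_neg (not_le.2 h)

theorem qBinomial_self (hq : ∀ k, qNumber q (k + 1) ≠ 0) (n : ℕ) : qBinomial q n n = 1 := by
  have h := qFactorial_ne_zero hq n
  have h0 : qFactorial q 0 = 1 := Finset.prod_range_zero _
  simp [qBinomial, h0, h]

/-- The `q`-Pascal rule. -/
theorem qBinomial_add_succ_succ (hq : ∀ k, qNumber q (k + 1) ≠ 0) (d k : ℕ) :
    qBinomial q (k + d + 1) (k + 1) =
      qBinomial q (k + d) (k + 1) + q ^ d * qBinomial q (k + d) k := by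
  rcases d with _ | d
  · simp [qBinomial_self hq, qBinomial_eq_zero_of_lt]
  have e1 : k + (d + 1) + 1 - (k + 1) = d + 1 := by omega
  have e2 : k + (d + 1) - (k + 1) = d := by omega
  have e3 : k + (d + 1) - k = d + 1 := by omega
  rw [qBinomial, qBinomial, qBinomial, if_pos (by omega), if_pos (by omega), if_pos (by omega),
    e1, e2, e3, qFactorial_succ q (k + (d + 1)), qFactorial_succ q k, qFactorial_succ q d,
    show k + (d + 1) + 1 = (d + 1) + (k + 1) by ring, qNumber_add q (d + 1) (k + 1)]
  have h1 := qFactorial_ne_zero hq k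
  have h2 := qFactorial_ne_zero hq d
  have h3 := hq k
  have h4 := hq d
  field_simp

/-- This is the recurrence of e_k(1, q, …, q ^ (v - 1)) on adjoining the variable q ^ v. -/
theorem pow_mul_qBinomial_succ_succ (hq : ∀ k, qNumber q (k + 1) ≠ 0) (v k : ℕ) :
    q ^ ((k + 1).choose 2) * qBinomial q (v + 1) (k + 1) =
      q ^ ((k + 1).choose 2) * qBinomial q v (k + 1) +
        q ^ v * (q ^ (k.choose 2) * qBinomial q v k) := by
  rcases le_or_gt k v with h | h
  · obtain ⟨d, rfl⟩ := Nat.exists_eq_add_of_le h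
    have hc : (k + 1).choose 2 = k.choose 2 + k := by
      rw [Nat.choose_succ_succ' k 1, Nat.choose_one_right, add_comm]
    rw [qBinomial_add_succ_succ hq, hc]
    ring
  · simp [qBinomial_eq_zero_of_lt h, qBinomial_eq_zero_of_lt (Nat.lt_succ_of_lt h),
      qBinomial_eq_zero_of_lt (Nat.succ_lt_succ h)]

/-- The alternating sum `∑ (-1) ^ k e_k(1, q, …, q ^ (v - 1)) N ^ (n - k)`. -/
def alternatingSum (q N : L) (v n : ℕ) : L :=
  ∑ k ∈ Finset.range (n + 1),
    (-1) ^ k * q ^ (k.choose 2) * qBinomial q v k * N ^ (n - k)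

theorem alternatingSum_zero_left (hq : ∀ k, qNumber q (k + 1) ≠ 0) (N : L) (n : ℕ) :
    alternatingSum q N 0 n = N ^ n := by
  rw [alternatingSum, Finset.sum_range_succ']
  simp [qBinomial_eq_zero_of_lt, qBinomial_zero_right hq]

theorem alternatingSum_zero_right (hq : ∀ k, qNumber q (k + 1) ≠ 0) (N : L) (v : ℕ) :
    alternatingSum q N v 0 = 1 := by
  simp [alternatingSum, qBinomial_zero_right hq]

/-- The sum is the coefficient of t ^ n in ∏_{i < v} (1 - q ^ i t) / (1 - N t); raising v multiplies
by 1 - q ^ v t. -/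
theorem alternatingSum_succ_succ (hq : ∀ k, qNumber q (k + 1) ≠ 0) (N : L) (v n : ℕ) :
    alternatingSum q N (v + 1) (n + 1) =
      alternatingSum q N v (n + 1) - q ^ v * alternatingSum q N v n := by
  rw [alternatingSum, alternatingSum, Finset.sum_range_succ', Finset.sum_range_succ' _ (n + 1),
    alternatingSum, Finset.mul_sum, add_sub_right_comm, ← Finset.sum_sub_distrib]
  simp only [qBinomial_zero_right hq]
  congr 1
  refine Finset.sum_congr rfl fun k _ => ?_
  rw [Nat.add_sub_add_right]
  linear_combination (-1) ^ (k + 1) * N ^ (n - k) * pow_mul_qBinomial_succ_succ hq v k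

theorem qNumber_X_ne_zero (K : Type*) [Field K] (k : ℕ) :
    qNumber (RatFunc.X : RatFunc K) (k + 1) ≠ 0 := by
  have h : qNumber (RatFunc.X : RatFunc K) (k + 1) =
      algebraMap (Polynomial K) (RatFunc K) (qNumber Polynomial.X (k + 1)) := by
    simp [qNumber]
  rw [h]
  -- The value at 0 is 1, in every characteristic.
  refine RatFunc.algebraMap_ne_zero fun h0 => ?_
  have := congrArg (Polynomial.eval 0) h0
  simp [qNumber, Finset.sum_range_succ', Polynomial.eval_finsetSum] at this

end QBinomial

/-! ### Generating functions of chains with prescribed strict drops -/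

section Chains

variable {L : Type*} [Field L]

/-- The sum of `q ^ (i 1 + ⋯ + i n)` over the sequences `m ≥ i 1 ≥ ⋯ ≥ i n ≥ c` with
`i j > i (j + 1)` whenever `j ∈ S`. -/
def chainSum (q : L) (S : Finset ℕ) : ℕ → ℕ → ℕ → L
  | 0, _, _ => 1
  | n + 1, m, c =>
    ∑ e ∈ Finset.Ico c (m + 1), q ^ e * chainSum q S n m (e + if n ∈ S then 1 else 0)

/-- Subtract 1 from each of the n entries. -/
theorem chainSum_succ_succ (q : L) (S : Finset ℕ) (n m c : ℕ) :
    chainSum q S n (m + 1) (c + 1) = q ^ n * chainSum q S n m c := by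
  induction n generalizing c with
  | zero => simp [chainSum]
  | succ n ih =>
    rw [chainSum, chainSum, ← Finset.sum_Ico_add' _ c (m + 1) 1, Finset.mul_sum]
    refine Finset.sum_congr rfl fun e _ => ?_
    rw [add_right_comm, ih]
    ring

/-- Split by whether the smallest entry is positive or zero. -/
theorem chainSum_succ_zero (q : L) (S : Finset ℕ) (n m : ℕ) :
    chainSum q S (n + 1) m 0 =
      chainSum q S (n + 1) m 1 + chainSum q S n m (if n ∈ S then 1 else 0) := by
  rw [chainSum, Finset.sum_eq_sum_Ico_succ_bot (Nat.succ_pos m), chainSum, add_comm]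
  simp

theorem chainSum_zero_one (q : L) (S : Finset ℕ) (n : ℕ) : chainSum q S (n + 1) 0 1 = 0 := by
  simp [chainSum]

open PowerSeries in
theorem mk_chainSum_succ (q : L) (S : Finset ℕ) (hS : 0 ∉ S) (n : ℕ) :
    (mk fun m => chainSum q S (n + 1) m 0) * (1 - X * C q ^ (n + 1)) =
      (mk fun m => chainSum q S n m 0) * (if n ∈ S then X * C q ^ n else 1) := by
  have e : ∀ (f : ℕ → L) (k : ℕ), mk f * (X * C q ^ k) = (C (q ^ k) * mk f) * X := by
    intro f k; rw [map_pow]; ring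
  ext m
  rw [mul_sub, mul_one, e]
  rcases m with _ | m
  · by_cases hn : n ∈ S
    -- With m = 0 no positive entry fits, but the empty chain would still count 1; `hS` excludes
    -- that case.
    · obtain ⟨k, rfl⟩ : ∃ k, n = k + 1 :=
        Nat.exists_eq_succ_of_ne_zero fun h => hS (h ▸ hn)
      simp only [if_pos hn, e, map_sub, coeff_zero_mul_X, coeff_mk, chainSum_succ_zero,
        chainSum_zero_one]
      simp
    · simp only [if_neg hn, map_sub, coeff_zero_mul_X, coeff_mk, chainSum_succ_zero q S n,
        chainSum_zero_one]
      simp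
  · by_cases hn : n ∈ S
    · simp only [if_pos hn, e, map_sub, coeff_succ_mul_X, coeff_C_mul, coeff_mk,
        chainSum_succ_zero q S n (m + 1)]
      rw [← zero_add 1, chainSum_succ_succ q S _ m 0, chainSum_succ_succ q S _ m 0]
      simp
    · simp only [if_neg hn, map_sub, coeff_succ_mul_X, coeff_C_mul, coeff_mk, mul_one,
        chainSum_succ_zero q S n (m + 1)]
      rw [← zero_add 1, chainSum_succ_succ q S _ m 0]
      simp

open PowerSeries in
theorem mk_chainSum_mul_qPochhammer (q : L) (S : Finset ℕ) (hS : 0 ∉ S) (n : ℕ) :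
    (mk fun m => chainSum q S n m 0) * qPochhammer X (C q) (n + 1) =
      ∏ i ∈ Finset.range n, if i ∈ S then X * C q ^ i else 1 := by
  induction n with
  | zero =>
    simp only [chainSum, qPochhammer, zero_add, Finset.prod_range_one, pow_zero, mul_one,
      Finset.prod_range_zero]
    exact mk_one_mul_one_sub_eq_one L
  | succ n ih =>
    rw [Finset.prod_range_succ, ← ih, qPochhammer, Finset.prod_range_succ, ← qPochhammer,
      mul_left_comm, mk_chainSum_succ q S hS]
    ring

/-- The condition `i 1 ≥ ⋯ ≥ i n ≥ c`, with a strict inequality after the positions in `S`. -/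
def IsChainAbove (S : Finset ℕ) {n : ℕ} (c : ℕ) (i : Fin n → ℕ) : Prop :=
  ∀ (k : ℕ) (hk : k < n),
    (if h : k + 1 < n then i ⟨k + 1, h⟩ + (if k + 1 ∈ S then 1 else 0) else c) ≤ i ⟨k, hk⟩

theorem isChainAbove_snoc (S : Finset ℕ) {n : ℕ} (c e : ℕ) (i : Fin n → ℕ) :
    IsChainAbove S c (Fin.snoc i e : Fin (n + 1) → ℕ) ↔
      c ≤ e ∧ IsChainAbove S (e + if n ∈ S then 1 else 0) i := by
  constructor
  · intro h
    refine ⟨by simpa [Fin.snoc] using h n (Nat.lt_succ_self n), fun k hk => ?_⟩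
    have := h k (Nat.lt_succ_of_lt hk)
    rw [dif_pos (Nat.succ_lt_succ hk)] at this
    rcases Nat.lt_or_ge (k + 1) n with h1 | h1
    · simpa [Fin.snoc, h1, hk] using this
    · obtain rfl : n = k + 1 := by omega
      simpa [Fin.snoc] using this
  · rintro ⟨h0, h⟩ k hk
    rcases Nat.lt_or_ge k n with h1 | h1
    · have := h k h1
      rcases Nat.lt_or_ge (k + 1) n with h2 | h2
      · simpa [Fin.snoc, h1, h2] using this
      · obtain rfl : n = k + 1 := by omega
        simpa [Fin.snoc] using this
    · obtain rfl : k = n := by omega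
      simpa [Fin.snoc] using h0

/-- The words of length `n` in the letters `0, …, m`. -/
def words (n m : ℕ) : Finset (Fin n → ℕ) := Fintype.piFinset fun _ => Finset.range (m + 1)

theorem mem_words {n m : ℕ} {a : Fin n → ℕ} : a ∈ words n m ↔ ∀ k, a k ≤ m := by
  simp [words]

open Classical in
theorem sum_isChainAbove (q : L) (S : Finset ℕ) (n m c : ℕ) :
    ∑ i ∈ words n m with IsChainAbove S c i, q ^ (∑ k, i k) = chainSum q S n m c := by
  induction n generalizing c with
  | zero =>
    have : (words 0 m).filter (IsChainAbove S c) = {Fin.elim0} := by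
      ext i
      simp [mem_words, IsChainAbove, Subsingleton.elim i Fin.elim0]
    rw [this]
    simp [chainSum]
  | succ n ih =>
    rw [chainSum]
    simp only [← ih, Finset.mul_sum]
    rw [Finset.sum_sigma']
    symm
    refine Finset.sum_bij' (fun p _ => (Fin.snoc p.2 p.1 : Fin (n + 1) → ℕ))
      (fun i _ => ⟨i (Fin.last n), Fin.init i⟩) ?_ ?_ ?_ ?_ ?_
    · rintro ⟨e, i⟩ h
      simp only [Finset.mem_sigma, Finset.mem_Ico, Finset.mem_filter, mem_words] at h ⊢
      refine ⟨fun k => ?_, (isChainAbove_snoc S c e i).2 ⟨h.1.1, h.2.2⟩⟩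
      refine Fin.lastCases ?_ (fun k => ?_) k
      · simpa using Nat.lt_succ_iff.1 h.1.2
      · simpa using h.2.1 k
    · intro i h
      simp only [Finset.mem_sigma, Finset.mem_Ico, Finset.mem_filter, mem_words] at h ⊢
      have h2 := h.2
      rw [← Fin.snoc_init_self i, isChainAbove_snoc] at h2
      exact ⟨⟨h2.1, Nat.lt_succ_iff.2 (h.1 _)⟩, fun k => h.1 _, h2.2⟩
    · rintro ⟨e, i⟩ h
      simp
    · intro i h
      simp
    · rintro ⟨e, i⟩ h
      simp [Fin.sum_univ_castSucc, pow_add, mul_comm]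

end Chains

/-! ### Inserting and erasing fixed letters -/

section FixedLetters

/-- The letter `v` placed between the words `l` and `r` is a fixed point of the stable sort of
`l ++ v :: r` into decreasing order: as many larger letters follow it as smaller ones
precede it. -/
def IsBalanced (v : ℕ) (l r : List ℕ) : Prop :=
  r.countP (fun x => decide (v < x)) = l.countP (fun x => decide (x < v))

/-- The letter `v` occurs in the word `a` as a fixed point of its stable decreasing sort. -/
def HasFixedLetter (v : ℕ) (a : List ℕ) : Prop :=
  ∃ l r, a = l ++ v :: r ∧ IsBalanced v l r

/-- Subtracting the two balance equations shows that `t` has no letter above or below `v`. -/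
theorem exists_eq_replicate_of_isBalanced {v : ℕ} {l t r : List ℕ}
    (h₁ : IsBalanced v l (t ++ r)) (h₂ : IsBalanced v (l ++ t) r) :
    ∃ k, t = List.replicate k v := by
  simp only [IsBalanced, List.countP_append] at h₁ h₂
  have h3 : t.countP (fun x => decide (v < x)) = 0 := by omega
  have h4 : t.countP (fun x => decide (x < v)) = 0 := by omega
  rw [List.countP_eq_zero] at h3 h4
  refine ⟨t.length, List.eq_replicate_iff.2 ⟨rfl, fun x hx => ?_⟩⟩
  have := h3 x hx
  have := h4 x hx
  simp only [decide_eq_true_eq] at *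
  omega

theorem cons_append_replicate (v k : ℕ) (r : List ℕ) :
    v :: (List.replicate k v ++ r) = List.replicate k v ++ v :: r := by
  rw [← List.cons_append, ← List.replicate_succ, List.replicate_succ', List.append_assoc,
    List.singleton_append]

theorem insert_eq_of_isBalanced {v : ℕ} {l r l' r' : List ℕ} (h : IsBalanced v l r)
    (h' : IsBalanced v l' r') (e : l ++ r = l' ++ r') : l ++ v :: r = l' ++ v :: r' := by
  rcases List.append_eq_append_iff.1 e with ⟨t, rfl, rfl⟩ | ⟨t, rfl, rfl⟩
  · obtain ⟨k, rfl⟩ := exists_eq_replicate_of_isBalanced h h'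
    rw [cons_append_replicate, List.append_assoc]
  · obtain ⟨k, rfl⟩ := exists_eq_replicate_of_isBalanced h' h
    rw [cons_append_replicate, List.append_assoc]

theorem isBalanced_append_cons_self {v : ℕ} {l t r : List ℕ} :
    IsBalanced v (l ++ v :: t) r ↔ IsBalanced v (l ++ t) r := by
  simp [IsBalanced, List.countP_append]

theorem isBalanced_self_append_cons {v : ℕ} {l t r : List ℕ} :
    IsBalanced v l (t ++ v :: r) ↔ IsBalanced v l (t ++ r) := by
  simp [IsBalanced, List.countP_append]

/-- Two balanced occurrences of `v` have only copies of `v` between them. This makes balanced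
insertion injective. -/
theorem erase_eq_of_isBalanced {v : ℕ} {l r l' r' : List ℕ} (h : IsBalanced v l r)
    (h' : IsBalanced v l' r') (e : l ++ v :: r = l' ++ v :: r') : l ++ r = l' ++ r' := by
  wlog hl : ∃ t, l' = l ++ t ∧ v :: r = t ++ v :: r' generalizing l r l' r'
  · rcases List.append_eq_append_iff.1 e with ⟨t, ht⟩ | ⟨t, ht⟩
    · exact (hl ⟨t, ht⟩).elim
    · exact (this h' h e.symm ⟨t, ht⟩).symm
  obtain ⟨t, rfl, ht⟩ := hl
  rcases t with _ | ⟨y, t⟩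
  · simpa using ht
  · obtain ⟨rfl, rfl⟩ : v = y ∧ r = t ++ v :: r' := by simpa using ht
    rw [isBalanced_self_append_cons] at h
    rw [isBalanced_append_cons_self] at h'
    obtain ⟨k, rfl⟩ := exists_eq_replicate_of_isBalanced h h'
    rw [← cons_append_replicate]
    simp

/-- Discrete intermediate values: moving one letter from right to left lowers the surplus of the
right count by at most 1, and at the end it is not positive. -/
theorem exists_isBalanced_of_le (v : ℕ) (l r : List ℕ)
    (h : l.countP (fun x => decide (x < v)) ≤ r.countP (fun x => decide (v < x))) :
    ∃ t s, r = t ++ s ∧ IsBalanced v (l ++ t) s := by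
  induction r generalizing l with
  | nil => exact ⟨[], [], rfl, by simpa [IsBalanced, eq_comm] using h⟩
  | cons x r ih =>
    rcases h.eq_or_lt with h | h
    · exact ⟨[], x :: r, rfl, by simpa [IsBalanced] using h.symm⟩
    · have : (l ++ [x]).countP (fun x => decide (x < v)) ≤
          r.countP (fun x => decide (v < x)) := by
        simp only [List.countP_append, List.countP_cons, List.countP_nil,
          decide_eq_true_eq] at h ⊢
        split_ifs at h ⊢ <;> omega
      obtain ⟨t, s, rfl, hs⟩ := ih _ this
      exact ⟨x :: t, s, rfl, by simpa using hs⟩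

theorem exists_isBalanced (v : ℕ) (b : List ℕ) :
    ∃ l r, b = l ++ r ∧ IsBalanced v l r :=
  exists_isBalanced_of_le v [] b (Nat.zero_le _)

theorem countP_le_countP_lt {u v : ℕ} (h : u < v) (l : List ℕ) :
    l.countP (fun x => decide (x < u)) ≤ l.countP (fun x => decide (x < v)) :=
  List.countP_mono_left fun x _ => by simp only [decide_eq_true_eq]; omega

theorem countP_le_countP_gt {u v : ℕ} (h : u < v) (l : List ℕ) :
    l.countP (fun x => decide (v < x)) ≤ l.countP (fun x => decide (u < x)) :=
  List.countP_mono_left fun x _ => by simp only [decide_eq_true_eq]; omega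

/-- A letter `u` left of a balanced place for `v` is itself counted there, which makes the
inequality strict. So `u` is not fixed, with or without `v` inserted. -/
theorem countP_lt_countP_of_isBalanced {u v : ℕ} (h : u < v) {l t r : List ℕ}
    (hb : IsBalanced v (l ++ u :: t) r) :
    l.countP (fun x => decide (x < u)) < (t ++ r).countP (fun x => decide (u < x)) := by
  have h1 := countP_le_countP_lt h l
  have h2 := countP_le_countP_gt h r
  simp only [IsBalanced, List.countP_append, List.countP_cons, decide_eq_true_eq, if_pos h] at hb ⊢
  omega

/-- Inserting a fixed letter `v` neither creates nor destroys fixed letters smaller than `v`. -/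
theorem hasFixedLetter_insert {u v : ℕ} (h : u < v) {l r : List ℕ} (hb : IsBalanced v l r) :
    HasFixedLetter u (l ++ v :: r) ↔ HasFixedLetter u (l ++ r) := by
  constructor
  · rintro ⟨l', r', e, h'⟩
    rcases List.append_eq_append_iff.1 e with ⟨t, rfl, ht⟩ | ⟨t, rfl, ht⟩
    · rcases t with _ | ⟨y, t⟩
      · simp only [List.nil_append, List.cons.injEq] at ht
        omega
      · obtain ⟨rfl, rfl⟩ : v = y ∧ r = t ++ u :: r' := by simpa using ht
        -- The larger letter `v` left of `u` enters neither count for `u`.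
        refine ⟨l ++ t, r', by simp, ?_⟩
        simpa [IsBalanced, List.countP_append, h.le] using h'
    · rcases t with _ | ⟨y, t⟩
      · simp only [List.nil_append, List.cons.injEq] at ht
        omega
      · obtain ⟨rfl, rfl⟩ : u = y ∧ r' = t ++ v :: r := by simpa using ht
        have := countP_lt_countP_of_isBalanced h hb
        simp only [IsBalanced, List.countP_append, List.countP_cons, decide_eq_true_eq,
          if_pos h] at h' this
        omega
  · rintro ⟨l', r', e, h'⟩
    rcases List.append_eq_append_iff.1 e with ⟨t, rfl, ht⟩ | ⟨t, rfl, ht⟩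
    · subst ht
      refine ⟨l ++ v :: t, r', by simp, ?_⟩
      simpa [IsBalanced, List.countP_append, h.le] using h'
    · rcases t with _ | ⟨y, t⟩
      · obtain rfl : r = u :: r' := by simpa using ht.symm
        refine ⟨l' ++ [v], r', by simp, ?_⟩
        simpa [IsBalanced, List.countP_append, h.le] using h'
      · obtain ⟨rfl, rfl⟩ : u = y ∧ r' = t ++ r := by simpa using ht
        have := countP_lt_countP_of_isBalanced h hb
        simp only [IsBalanced] at h'
        omega

end FixedLetters

/-! ### Words without small fixed letters -/

section ListWords

variable {L : Type*} [Field L]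

/-- The words of length `n` in the letters `0, …, m`, as lists. -/
def listWords (n m : ℕ) : Finset (List ℕ) := (words n m).image List.ofFn

theorem mem_listWords {n m : ℕ} {a : List ℕ} :
    a ∈ listWords n m ↔ a.length = n ∧ ∀ x ∈ a, x ≤ m := by
  simp only [listWords, Finset.mem_image, mem_words]
  constructor
  · rintro ⟨f, hf, rfl⟩
    refine ⟨List.length_ofFn, fun x hx => ?_⟩
    obtain ⟨k, rfl⟩ := List.mem_ofFn.1 hx
    exact hf k
  · rintro ⟨rfl, h⟩
    exact ⟨a.get, fun k => h _ (List.get_mem _ _), List.ofFn_get a⟩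

open Classical in
/-- The sum of `q ^ (a 1 + ⋯ + a n)` over the words without fixed letters smaller than `v`. -/
noncomputable def fixedFreeSum (q : L) (m v n : ℕ) : L :=
  ∑ a ∈ listWords n m with ∀ u < v, ¬ HasFixedLetter u a, q ^ a.sum

open Classical in
theorem sum_hasFixedLetter (q : L) {m v : ℕ} (hv : v ≤ m) (n : ℕ) :
    ∑ a ∈ listWords (n + 1) m with (∀ u < v, ¬ HasFixedLetter u a) ∧ HasFixedLetter v a,
      q ^ a.sum = q ^ v * fixedFreeSum q m v n := by
  rw [fixedFreeSum, Finset.mul_sum]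
  symm
  -- Any choice of balanced place serves, since all yield the same inserted word.
  choose l r hlr hb using exists_isBalanced v
  refine Finset.sum_bij (fun b _ => l b ++ v :: r b) ?_ ?_ ?_ ?_
  · intro b h
    simp only [Finset.mem_filter, mem_listWords] at h ⊢
    obtain ⟨⟨hn, hm⟩, hf⟩ := h
    refine ⟨⟨?_, fun x hx => ?_⟩, fun u hu => ?_, l b, r b, rfl, hb b⟩
    · rw [← hn]
      conv_rhs => rw [hlr b]
      simp [add_assoc]
    · rw [List.mem_append, List.mem_cons] at hx
      rcases hx with hx | rfl | hx
      · exact hm x (hlr b ▸ List.mem_append_left _ hx)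
      · exact hv
      · exact hm x (hlr b ▸ List.mem_append_right _ hx)
    · rw [hasFixedLetter_insert hu (hb b), ← hlr b]
      exact hf u hu
  · intro b _ b' _ e
    rw [hlr b, hlr b']
    exact erase_eq_of_isBalanced (hb b) (hb b') e
  · intro a h
    simp only [Finset.mem_filter, mem_listWords] at h
    obtain ⟨⟨hn, hm⟩, hf, s, t, rfl, hst⟩ := h
    refine ⟨s ++ t, ?_, insert_eq_of_isBalanced (hb _) hst (hlr _).symm⟩
    simp only [Finset.mem_filter, mem_listWords]
    refine ⟨⟨?_, fun x hx => hm x ?_⟩, fun u hu => ?_⟩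
    · simp only [List.length_append, List.length_cons] at hn ⊢
      omega
    · simp only [List.mem_append, List.mem_cons] at hx ⊢
      tauto
    · rw [← hasFixedLetter_insert hu hst]
      exact hf u hu
  · intro b _
    conv_lhs => rw [hlr b]
    simp only [List.sum_append, List.sum_cons, pow_add]
    ring

open Classical in
theorem fixedFreeSum_succ_succ (q : L) {m v : ℕ} (hv : v ≤ m) (n : ℕ) :
    fixedFreeSum q m (v + 1) (n + 1) =
      fixedFreeSum q m v (n + 1) - q ^ v * fixedFreeSum q m v n := by
  rw [← sum_hasFixedLetter q hv, eq_sub_iff_add_eq, fixedFreeSum, fixedFreeSum,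
    ← Finset.sum_filter_add_sum_filter_not
      ((listWords (n + 1) m).filter fun a => ∀ u < v, ¬ HasFixedLetter u a)
      (fun a => ¬ HasFixedLetter v a), Finset.filter_filter, Finset.filter_filter]
  simp only [not_not, Nat.lt_succ_iff_lt_or_eq, or_imp, forall_and, forall_eq]

theorem sum_listWords (n m : ℕ) (p : List ℕ → Prop) [DecidablePred p] (q : L) :
    ∑ a ∈ listWords n m with p a, q ^ a.sum =
      ∑ a ∈ words n m with p (List.ofFn a), q ^ (∑ k, a k) := by
  rw [listWords, Finset.filter_image, Finset.sum_image List.ofFn_injective.injOn]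
  simp [List.sum_ofFn]

theorem fixedFreeSum_zero_left (q : L) (m n : ℕ) :
    fixedFreeSum q m 0 n = qNumber q (m + 1) ^ n := by
  classical
  rw [fixedFreeSum, sum_listWords]
  simp only [Nat.not_lt_zero, false_imp_iff, implies_true, Finset.filter_true]
  rw [words, qNumber, ← Fin.prod_const, Finset.prod_univ_sum]
  simp [Finset.prod_pow_eq_pow_sum]

theorem fixedFreeSum_zero_right (q : L) (m v : ℕ) : fixedFreeSum q m v 0 = 1 := by
  classical
  have : (listWords 0 m).filter (fun a => ∀ u < v, ¬ HasFixedLetter u a) = {[]} := by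
    ext a
    simp only [Finset.mem_filter, mem_listWords, Finset.mem_singleton, List.length_eq_zero_iff]
    constructor
    · exact fun h => h.1.1
    · rintro rfl
      simp [HasFixedLetter]
  rw [fixedFreeSum, this]
  simp

theorem fixedFreeSum_eq_alternatingSum {q : L} (hq : ∀ k, qNumber q (k + 1) ≠ 0) {m v : ℕ}
    (hv : v ≤ m + 1) (n : ℕ) :
    fixedFreeSum q m v n = alternatingSum q (qNumber q (m + 1)) v n := by
  induction v generalizing n with
  | zero => rw [fixedFreeSum_zero_left, alternatingSum_zero_left hq]
  | succ v ih =>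
    cases n with
    | zero => rw [fixedFreeSum_zero_right, alternatingSum_zero_right hq]
    | succ n =>
      rw [fixedFreeSum_succ_succ q (Nat.lt_succ_iff.1 hv), alternatingSum_succ_succ hq,
        ih (Nat.le_of_succ_le hv), ih (Nat.le_of_succ_le hv)]

end ListWords

/-! ### Fixed points of the stable sort -/

section Sorting

/-- The permutation that sorts a word stably into decreasing order. -/
def sortDesc {n : ℕ} (a : Fin n → ℕ) : Equiv.Perm (Fin n) := Tuple.sort (OrderDual.toDual ∘ a)

theorem succ_mem_descentSet {n : ℕ} {w : Equiv.Perm (Fin n)} {k : ℕ} (h : k + 1 < n) :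
    k + 1 ∈ descentSet w ↔ w ⟨k + 1, h⟩ < w ⟨k, Nat.lt_of_succ_lt h⟩ := by
  simp [descentSet, h]

theorem zero_notMem_descentSet {n : ℕ} (w : Equiv.Perm (Fin n)) : 0 ∉ descentSet w := by
  simp [descentSet]

theorem eq_sortDesc_iff_forall_lt {n : ℕ} (a : Fin n → ℕ) (w : Equiv.Perm (Fin n)) :
    w = sortDesc a ↔ ∀ j k, j < k → a (w k) < a (w j) ∨ a (w j) = a (w k) ∧ w j < w k := by
  rw [sortDesc, Tuple.eq_sort_iff']
  exact forall₂_congr fun j k => imp_congr_right fun _ => Prod.Lex.toLex_lt_toLex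

/-- Consecutive comparisons suffice, and stability allows a tie exactly where `w` ascends. -/
theorem eq_sortDesc_iff {n : ℕ} (a : Fin n → ℕ) (w : Equiv.Perm (Fin n)) :
    w = sortDesc a ↔ IsChainAbove (descentSet w) 0 (a ∘ w) := by
  rcases n with _ | n
  · exact ⟨fun _ k hk => absurd hk (Nat.not_lt_zero k), fun _ => Subsingleton.elim _ _⟩
  rw [sortDesc, Tuple.eq_sort_iff', Fin.strictMono_iff_lt_succ]
  have key : ∀ k : Fin n, (w.trans (Tuple.graphEquiv₁ (OrderDual.toDual ∘ a))) k.castSucc <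
      (w.trans (Tuple.graphEquiv₁ (OrderDual.toDual ∘ a))) k.succ ↔
      a (w k.succ) + (if (k : ℕ) + 1 ∈ descentSet w then 1 else 0) ≤ a (w k.castSucc) := by
    intro k
    have h1 : (w.trans (Tuple.graphEquiv₁ (OrderDual.toDual ∘ a))) k.castSucc <
        (w.trans (Tuple.graphEquiv₁ (OrderDual.toDual ∘ a))) k.succ ↔
        a (w k.succ) < a (w k.castSucc) ∨
          a (w k.castSucc) = a (w k.succ) ∧ w k.castSucc < w k.succ :=
      Prod.Lex.toLex_lt_toLex
    have h2 : (k : ℕ) + 1 ∈ descentSet w ↔ w k.succ < w k.castSucc :=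
      succ_mem_descentSet (Nat.succ_lt_succ k.2)
    have h3 : w k.castSucc ≠ w k.succ := fun h => (Fin.castSucc_lt_succ (i := k)).ne (w.injective h)
    rw [h1]
    rcases lt_or_gt_of_ne h3 with h | h
    · rw [if_neg (h2.not.2 h.not_gt)]
      simp only [h, and_true, add_zero]
      omega
    · rw [if_pos (h2.2 h)]
      simp only [h.not_gt, and_false, or_false]
      omega
  simp only [key]
  constructor
  · intro h k hk
    by_cases h1 : k + 1 < n + 1
    · rw [dif_pos h1]
      exact h ⟨k, Nat.lt_of_succ_lt_succ h1⟩
    · rw [dif_neg h1]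
      exact Nat.zero_le _
  · intro h k
    have := h k (Nat.lt_succ_of_lt k.2)
    rwa [dif_pos (Nat.succ_lt_succ k.2)] at this

theorem card_filter_sortDesc {n : ℕ} (a : Fin n → ℕ) (p : Fin n) :
    (Finset.univ.filter fun r => a p < a r ∨ a r = a p ∧ r < p).card =
      ((sortDesc a).symm p : ℕ) := by
  have h := (eq_sortDesc_iff_forall_lt a (sortDesc a)).1 rfl
  obtain ⟨k, rfl⟩ := (sortDesc a).surjective p
  rw [Equiv.symm_apply_apply, ← Fin.card_Iio k,
    ← Finset.card_map (sortDesc a).toEmbedding (s := Finset.Iio k)]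
  congr 1
  ext r
  obtain ⟨j, rfl⟩ := (sortDesc a).surjective r
  simp only [Finset.mem_filter, Finset.mem_univ, true_and, Finset.mem_map_equiv,
    Equiv.symm_apply_apply, Finset.mem_Iio]
  refine ⟨fun hj => ?_, h j k⟩
  by_contra hjk
  rcases (not_lt.1 hjk).eq_or_lt with rfl | hkj
  · simp at hj
  · have := h k j hkj
    rw [Fin.lt_def] at *
    omega

theorem sortDesc_apply_eq_self_iff {n : ℕ} (a : Fin n → ℕ) (p : Fin n) :
    sortDesc a p = p ↔
      (Finset.univ.filter fun r => a p < a r ∨ a r = a p ∧ r < p).card = (p : ℕ) := by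
  rw [card_filter_sortDesc, Fin.val_inj, Equiv.symm_apply_eq, eq_comm]

theorem countP_take_ofFn {n : ℕ} (a : Fin n → ℕ) (P : ℕ → Bool) {p : ℕ} (hp : p ≤ n) :
    ((List.ofFn a).take p).countP P =
      (Finset.univ.filter fun r : Fin n => (r : ℕ) < p ∧ P (a r) = true).card := by
  induction p with
  | zero => simp
  | succ p ih =>
    have h1 : (List.ofFn a).take (p + 1) = (List.ofFn a).take p ++ [a ⟨p, hp⟩] := by
      rw [List.take_add_one, List.getElem?_ofFn, dif_pos (Nat.lt_of_succ_le hp)]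
      rfl
    have h2 : (Finset.univ.filter fun r : Fin n => (r : ℕ) < p + 1 ∧ P (a r) = true) =
        (Finset.univ.filter fun r : Fin n => (r : ℕ) < p ∧ P (a r) = true) ∪
          (Finset.univ.filter fun r : Fin n => r = ⟨p, hp⟩ ∧ P (a ⟨p, hp⟩) = true) := by
      ext r
      simp only [Finset.mem_filter, Finset.mem_univ, true_and, Finset.mem_union,
        Nat.lt_succ_iff_lt_or_eq, or_and_right]
      refine or_congr Iff.rfl ⟨fun h => ?_, fun h => ?_⟩
      · obtain rfl : r = ⟨p, hp⟩ := Fin.ext h.1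
        exact ⟨rfl, h.2⟩
      · obtain ⟨rfl, h⟩ := h
        exact ⟨rfl, h⟩
    rw [h1, List.countP_append, ih (Nat.le_of_succ_le hp), h2, Finset.card_union_of_disjoint]
    · congr 1
      by_cases h : P (a ⟨p, hp⟩) = true
      · simp [h, Finset.filter_eq']
      · simp [h]
    · rw [Finset.disjoint_filter]
      rintro r - ⟨h, -⟩ ⟨rfl, -⟩
      exact lt_irrefl _ h

theorem countP_ofFn {n : ℕ} (a : Fin n → ℕ) (P : ℕ → Bool) :
    (List.ofFn a).countP P = (Finset.univ.filter fun r : Fin n => P (a r) = true).card := by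
  have h := countP_take_ofFn a P le_rfl
  rw [List.take_of_length_le (by simp)] at h
  simpa using h

theorem length_eq_countP_add (v : ℕ) (l : List ℕ) :
    l.length = l.countP (fun x => decide (x < v)) + l.countP (fun x => decide (x = v)) +
      l.countP (fun x => decide (v < x)) := by
  induction l with
  | nil => rfl
  | cons x l ih =>
    simp only [List.length_cons, List.countP_cons, decide_eq_true_eq]
    split_ifs <;> omega

/-- The letters sorted before `a p` are the larger ones and the earlier equal ones; `p` counts all
earlier letters. Earlier equal and earlier larger letters cancel. -/
theorem sortDesc_apply_eq_self_iff_isBalanced {n : ℕ} (a : Fin n → ℕ) (p : Fin n)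
    {l r : List ℕ} (hl : l.length = p) (h : List.ofFn a = l ++ a p :: r) :
    sortDesc a p = p ↔ IsBalanced (a p) l r := by
  have h1 := countP_ofFn a fun x => decide (a p < x)
  have h2 := countP_take_ofFn a (fun x => decide (x = a p)) p.2.le
  have h3 := length_eq_countP_add (a p) l
  rw [h, ← hl, List.take_left] at h2
  rw [h] at h1
  have h4 : (Finset.univ.filter fun r => a p < a r ∨ a r = a p ∧ r < p).card =
      (l ++ a p :: r).countP (fun x => decide (a p < x)) +
        l.countP (fun x => decide (x = a p)) := by
    rw [h1, h2, Finset.filter_or, Finset.card_union_of_disjoint]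
    · simp [hl, and_comm]
    · rw [Finset.disjoint_filter]
      rintro r - h ⟨h', -⟩
      omega
  rw [sortDesc_apply_eq_self_iff, h4, ← hl, IsBalanced]
  simp only [List.countP_append, List.countP_cons, lt_irrefl, decide_false] at h3 ⊢
  simp only [Bool.false_eq_true, if_false]
  omega

theorem hasFixedLetter_ofFn_iff {n : ℕ} (a : Fin n → ℕ) (v : ℕ) :
    HasFixedLetter v (List.ofFn a) ↔ ∃ p, a p = v ∧ sortDesc a p = p := by
  constructor
  · rintro ⟨l, r, e, h⟩
    have hn : l.length < n := by
      have := congrArg List.length e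
      simp only [List.length_ofFn, List.length_append, List.length_cons] at this
      omega
    have hv : a ⟨l.length, hn⟩ = v := by
      have := congrArg (fun t : List ℕ => t[l.length]?) e
      simpa [List.getElem?_ofFn, hn] using this
    subst hv
    exact ⟨_, rfl, (sortDesc_apply_eq_self_iff_isBalanced a ⟨l.length, hn⟩ rfl e).2 h⟩
  · rintro ⟨p, rfl, hp⟩
    have hlen : (p : ℕ) < (List.ofFn a).length := by simp
    have e : List.ofFn a = (List.ofFn a).take p ++ a p :: (List.ofFn a).drop (p + 1) := by
      conv_lhs => rw [← List.take_append_drop p (List.ofFn a), List.drop_eq_getElem_cons hlen]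
      simp
    refine ⟨_, _, e, (sortDesc_apply_eq_self_iff_isBalanced a p ?_ e).1 hp⟩
    simp

end Sorting

/-! ### Summation over derangements -/

section Main

variable {L : Type*} [Field L]

theorem sum_sortDesc_eq (q : L) {n : ℕ} (m : ℕ) (w : Equiv.Perm (Fin n)) :
    ∑ a ∈ words n m with sortDesc a = w, q ^ (∑ k, a k) =
      chainSum q (descentSet w) n m 0 := by
  classical
  rw [← sum_isChainAbove]
  refine Finset.sum_bij' (fun a _ => a ∘ w) (fun i _ => i ∘ w.symm) ?_ ?_ ?_ ?_ ?_
  · intro a h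
    rw [Finset.mem_filter, mem_words] at h ⊢
    exact ⟨fun k => h.1 _, (eq_sortDesc_iff a w).1 h.2.symm⟩
  · intro i h
    rw [Finset.mem_filter, mem_words] at h ⊢
    refine ⟨fun k => h.1 _, ((eq_sortDesc_iff _ w).2 ?_).symm⟩
    rw [Function.comp_assoc, Equiv.symm_comp_self]
    exact h.2
  · intro a _
    rw [Function.comp_assoc, Equiv.self_comp_symm, Function.comp_id]
  · intro i _
    rw [Function.comp_assoc, Equiv.symm_comp_self, Function.comp_id]
  · intro a _
    rw [← Equiv.sum_comp w]
    rfl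

theorem sum_derangements_chainSum (q : L) (n m : ℕ) :
    ∑ w ∈ Finset.univ.filter (fun w : Equiv.Perm (Fin n) => w ∈ derangements (Fin n)),
      chainSum q (descentSet w) n m 0 = fixedFreeSum q m (m + 1) n := by
  classical
  rw [fixedFreeSum, sum_listWords]
  have h : ((words n m).filter fun a => ∀ u < m + 1, ¬ HasFixedLetter u (List.ofFn a)) =
      (words n m).filter fun a => sortDesc a ∈ derangements (Fin n) := by
    refine Finset.filter_congr fun a ha => ?_
    rw [mem_words] at ha
    simp only [hasFixedLetter_ofFn_iff, not_exists, not_and]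
    exact ⟨fun h p => h _ (Nat.lt_succ_iff.2 (ha p)) p rfl, fun h _ _ p _ => h p⟩
  rw [h, ← Finset.sum_fiberwise_of_maps_to (g := sortDesc)
    (t := Finset.univ.filter fun w => w ∈ derangements (Fin n))
    (fun a ha => by simpa using (Finset.mem_filter.1 ha).2)]
  refine Finset.sum_congr rfl fun w hw => ?_
  rw [← sum_sortDesc_eq, Finset.filter_filter]
  refine Finset.sum_congr (Finset.filter_congr fun a _ => ?_) fun _ _ => rfl
  exact ⟨fun e => ⟨e ▸ (Finset.mem_filter.1 hw).2, e⟩, fun e => e.2⟩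

open PowerSeries in
theorem mk_chainSum_descentSet (q : L) {n : ℕ} (w : Equiv.Perm (Fin n)) :
    (mk fun m => chainSum q (descentSet w) n m 0) * qPochhammer X (C q) (n + 1) =
      X ^ des w * C q ^ maj w := by
  rw [mk_chainSum_mul_qPochhammer q _ (zero_notMem_descentSet w), ← Finset.prod_filter]
  have h : (Finset.range n).filter (fun i => i ∈ descentSet w) = descentSet w := by
    ext i
    simp only [Finset.mem_filter, Finset.mem_range, and_iff_right_iff_imp]
    intro hi
    exact (Finset.mem_Ico.1 (Finset.mem_filter.1 hi).1).2
  rw [h, Finset.prod_mul_distrib, Finset.prod_const, Finset.prod_pow_eq_pow_sum]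
  rfl

end Main

end EulerMahonian

/-- An identity of formal power series in `x = PowerSeries.X` over the field `K(q)` of rational
functions in `q = RatFunc.X`. The inverse on the right is a true inverse, as `(x; q)_{n+1}` has
constant term `1`. -/
theorem theorem4p5 (K : Type*) [Field K] (n : ℕ) (hn : 0 < n) :
    (PowerSeries.mk fun m : ℕ =>
        ∑ k ∈ Finset.range (n + 1),
          (-1) ^ k * (RatFunc.X : RatFunc K) ^ (k.choose 2) *
            EulerMahonian.qBinomial (RatFunc.X : RatFunc K) (m + 1) k *
            EulerMahonian.qNumber (RatFunc.X : RatFunc K) (m + 1) ^ (n - k)) =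
      EulerMahonian.derangementPoly n (PowerSeries.X : PowerSeries (RatFunc K))
          (PowerSeries.C (RatFunc.X : RatFunc K)) *
        (EulerMahonian.qPochhammer (PowerSeries.X : PowerSeries (RatFunc K))
          (PowerSeries.C (RatFunc.X : RatFunc K)) (n + 1))⁻¹ := by
  have h0 : PowerSeries.constantCoeff (EulerMahonian.qPochhammer
      (PowerSeries.X : PowerSeries (RatFunc K))
      (PowerSeries.C (RatFunc.X : RatFunc K)) (n + 1)) ≠ 0 := by
    simp [EulerMahonian.qPochhammer, map_prod]
  rw [PowerSeries.eq_mul_inv_iff_mul_eq h0, EulerMahonian.derangementPoly]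
  simp only [← EulerMahonian.mk_chainSum_descentSet]
  rw [← Finset.sum_mul]
  congr 1
  ext m
  rw [map_sum]
  simp only [PowerSeries.coeff_mk]
  -- Here v = m + 1, so every letter of the alphabet is forbidden as a fixed letter.
  rw [EulerMahonian.sum_derangements_chainSum,
    EulerMahonian.fixedFreeSum_eq_alternatingSum (EulerMahonian.qNumber_X_ne_zero K) le_rfl]
  rfl
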